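/- Let $AP$ be a finite non-empty set of atomic propositions. PCTL state formulas $\Phi$ and path formulas $\varphi$ over $AP$ are given by $\Phi ::= a \mid \Phi\wedge\Phi \mid \Phi\vee\Phi \mid \neg\Phi \mid \mathbb P_{\bowtie q}(\varphi)$ and $\varphi ::= \mathsf X\Phi \mid \Phi\,\mathsf U\,\Phi \mid \Phi\,\mathsf W\,\Phi$, where $a\in AP$, $\bowtie\,\in\{<,>,\le,\ge\}$ and $q\in[0,1]$. A Markov chain (MC) $D$ has a countable state space $S$, a probability distribution $\mu_s$ on $S$ for each $s\in S$, a labelling $L:S\to 2^{AP}$ and an initial state $s_0$. The Boolean connectives are interpreted as usual, and $s\models a$ iff $a\in L(s)$; $s\models \mathbb P_{\bowtie q}(\varphi)$ iff the probability that an infinite path of $D$ started in $s$ satisfies $\varphi$ is $\bowtie q$. A path $\pi$ satisfies $\mathsf X\Phi$ iff $\pi[1]\models\Phi$; it satisfies $\Phi_1\mathsf U\Phi_2$ iff $\pi[j]\models\Phi_2$ for some $j\ge 0$ and $\pi[k]\models\Phi_1$ for all $k<j$; it satisfies $\Phi_1\mathsf W\Phi_2$ iff it satisfies $\Phi_1\mathsf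 U\Phi_2$ or $\pi[i]\models\Phi_1$ for all $i\ge0$. $D\models\Phi$ means $s_0\models\Phi$. Formulas are identified with their positive normal forms, obtained by pushing negations inwards to the atomic propositions by De Morgan's laws, $\neg\neg\Phi\equiv\Phi$, and $\neg\mathbb P_{\bowtie q}(\varphi)\equiv\mathbb P_{\bowtie' q}(\varphi)$ with $\bowtie'$ the complementary comparison. The fragment $\mathrm{PCTL}_{safe}$ is the smallest set $\mathcal F$ of state formulas such that, for all $q\in[0,1]$: (1) every Boolean combination of atomic propositions is in $\mathcal F$; (2) if $\Phi\in\mathcal F$, then $\mathbb P_{\ge q}(\mathsf X\Phi)\in\mathcal F$; (3) if $\Phi_1,\Phi_2\in\mathcal F$, then $\Phi_1\wedge\Phi_2$, $\Phi_1\vee\Phi_2$ and $\mathbb P_{\ge q}(\Phi_1\mathsf W\Phi_2)$ are in $\mathcal F$; (4) if $\neg\Phi_1,\neg\Phi_2\in\mathcal F$, then $\mathbb P_{\le q}(\Phi_1\mathsf U\Phi_2)\in\mathcal F$. A probabilistic tree (PT) $T=(W,L,P)$ consists of a set $W$ of non-empty finite sequences over $\mathbb N$ that is closed under non-empty prefixes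 and has exactly one element of length one (the root), a labelling $L:W\to2^{AP}$, and a partial map $P$ from $W$ to the distributions on $W$ such that $P(\pi)(\pi')>0$ iff $\pi'=\pi\cdot n\in W$ for some $n\in\mathbb N$; $P$ is undefined exactly at the leaves, where $P(\pi)(\pi')$ is read as $0$. $T$ is total if every node has a proper extension in $W$, and of finite depth if the lengths of its nodes are bounded. $T_1$ is a prefix of $T_2$, written $T_1\preceq T_2$, if $W_1\subseteq W_2$ and the restrictions of $L_2$ to $W_1$ and of $P_2$ to $W_1\times W_1$ are $L_1$ and $P_1$. A set $\mathcal P$ of total PTs is a safety property if for every total PT $T$: $T\in \mathcal P$ iff for every finite-depth prefix $T_1$ of $T$ there is $T_2\in \mathcal P$ with $T_1\preceq T_2$. The unfolding $T(D)$ of an MC $D$ is the tree whose nodes are the finite sequences $s_0s_1\dots s_n$ of states with $\mu_{s_i}(s_{i+1})>0$ for all $i<n$; a node is labelled with the label of its last state, and the edge from $\pi$ to $\pi\cdot t$ has probability $\mu_s(t)$, where $s$ is the last state of $\pi$. If $S=\mathbb N$, it is a total PT; in general it is one after renaming its nodes. **Theorem.** Every formula $\Phi\in\mathrm{PCTL}_{safe}$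 is a safety property. That is, the set of all total PTs that are, up to isomorphism (renaming of nodes), unfoldings of MCs $D$ with $D\models\Phi$ is a safety property; and so is the set $\{T(D)\mid D \text{ an MC with state space } \mathbb N,\ D\models\Phi\}$ of literal unfoldings. -/

import Mathlib

open MeasureTheory ProbabilityTheory
open scoped ENNReal

namespace PCTL

universe u

/-! ### Discrete-time Markov chains and their path measures -/

/-- A (state-labelled, discrete-time) Markov chain with state space `S` over the atomic
propositions `AP`. The state space is required to be countable wherever chains are used. -/
structure MarkovChain (S : Type*) (AP : Type*) where
  step : S → PMF S
  label : S → Set AP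
  init : S

namespace MarkovChain

variable {S AP : Type*}

/-- The one-step transition kernel, on the discrete `σ`-algebra of the state space. -/
noncomputable def stepKernel (D : MarkovChain S AP) : @Kernel S S ⊤ ⊤ :=
  letI : MeasurableSpace S := ⊤
  { toFun := fun s => (D.step s).toMeasure
    measurable' := measurable_from_top }

instance (D : MarkovChain S AP) : @IsMarkovKernel S S ⊤ ⊤ D.stepKernel :=
  letI : MeasurableSpace S := ⊤
  ⟨fun s => inferInstanceAs (IsProbabilityMeasure (D.step s).toMeasure)⟩

/-- The `σ`-algebra on infinite paths: the product of the discrete ones. For countable `S` this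
is the one generated by the cylinder sets. -/
abbrev pathSpace (S : Type*) : MeasurableSpace (ℕ → S) :=
  @MeasurableSpace.pi ℕ (fun _ => S) (fun _ => ⊤)

/-- The probability measure on the infinite paths of the chain when it is started in `s`:
the measure of the cylinder set of `s s₁ … sₙ` is the product of the one-step probabilities. -/
noncomputable def pathMeasure (D : MarkovChain S AP) (s : S) : @Measure (ℕ → S) (pathSpace S) :=
  letI : MeasurableSpace S := ⊤
  Kernel.traj (X := fun _ => S)
    (fun n => D.stepKernel.comap
      (fun x : (i : Finset.Iic n) → S => x ⟨n, Finset.mem_Iic.2 le_rfl⟩) (measurable_pi_apply _))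
    0 (fun _ => s)

end MarkovChain

/-! ### Syntax of PCTL -/

/-- The binary comparison operators `<`, `>`, `≤`, `≥`. -/
inductive Comparison
  | lt | gt | le | ge

namespace Comparison

/-- `c.Holds p q` means `p ⋈ q`. -/
def Holds : Comparison → ℝ → ℝ → Prop
  | lt, p, q => p < q
  | gt, p, q => p > q
  | le, p, q => p ≤ q
  | ge, p, q => p ≥ q

/-- The complementary comparison. -/
def compl : Comparison → Comparison
  | lt => ge
  | gt => le
  | le => gt
  | ge => lt

end Comparison

/- PCTL state formulas and path formulas. Disjunction is a constructor of its own (and not an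
abbreviation) since it is needed to write down positive normal forms. -/
mutual

inductive StateFormula (AP : Type u)
  | atom (a : AP) : StateFormula AP
  | and (Φ₁ Φ₂ : StateFormula AP) : StateFormula AP
  | or (Φ₁ Φ₂ : StateFormula AP) : StateFormula AP
  | not (Φ : StateFormula AP) : StateFormula AP
  | prob (c : Comparison) (q : unitInterval) (φ : PathFormula AP) : StateFormula AP

inductive PathFormula (AP : Type u)
  | next (Φ : StateFormula AP) : PathFormula AP
  | untl (Φ₁ Φ₂ : StateFormula AP) : PathFormula AP
  | wuntl (Φ₁ Φ₂ : StateFormula AP) : PathFormula AP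

end

/- Positive normal form. `Φ.pnf` pushes the negations of `Φ` inwards until they are adjacent to
atomic propositions, and `Φ.pnfNeg` is the positive normal form of the negation of `Φ`. -/
mutual

def StateFormula.pnf {AP : Type*} : StateFormula AP → StateFormula AP
  | .atom a => .atom a
  | .and Φ₁ Φ₂ => .and Φ₁.pnf Φ₂.pnf
  | .or Φ₁ Φ₂ => .or Φ₁.pnf Φ₂.pnf
  | .not Φ => Φ.pnfNeg
  | .prob c q φ => .prob c q φ.pnf

def StateFormula.pnfNeg {AP : Type*} : StateFormula AP → StateFormula AP
  | .atom a => .not (.atom a)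
  | .and Φ₁ Φ₂ => .or Φ₁.pnfNeg Φ₂.pnfNeg
  | .or Φ₁ Φ₂ => .and Φ₁.pnfNeg Φ₂.pnfNeg
  | .not Φ => Φ.pnf
  | .prob c q φ => .prob c.compl q φ.pnf

def PathFormula.pnf {AP : Type*} : PathFormula AP → PathFormula AP
  | .next Φ => .next Φ.pnf
  | .untl Φ₁ Φ₂ => .untl Φ₁.pnf Φ₂.pnf
  | .wuntl Φ₁ Φ₂ => .wuntl Φ₁.pnf Φ₂.pnf

end

/-! ### Semantics of PCTL -/

/- `D.Sat Φ s` means `s ⊨ Φ`, and `D.PathSat φ π` means `π ⊨ φ`, in the chain `D`. -/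
mutual

def MarkovChain.Sat {S AP : Type*} (D : MarkovChain S AP) : StateFormula AP → S → Prop
  | .atom a, s => a ∈ D.label s
  | .and Φ₁ Φ₂, s => D.Sat Φ₁ s ∧ D.Sat Φ₂ s
  | .or Φ₁ Φ₂, s => D.Sat Φ₁ s ∨ D.Sat Φ₂ s
  | .not Φ, s => ¬ D.Sat Φ s
  | .prob c q φ, s =>
      c.Holds (D.pathMeasure s {π : ℕ → S | π 0 = s ∧ D.PathSat φ π}).toReal (q : ℝ)

def MarkovChain.PathSat {S AP : Type*} (D : MarkovChain S AP) : PathFormula AP → (ℕ → S) → Prop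
  | .next Φ, π => D.Sat Φ (π 1)
  | .untl Φ₁ Φ₂, π => ∃ j, D.Sat Φ₂ (π j) ∧ ∀ k < j, D.Sat Φ₁ (π k)
  | .wuntl Φ₁ Φ₂, π =>
      (∃ j, D.Sat Φ₂ (π j) ∧ ∀ k < j, D.Sat Φ₁ (π k)) ∨ ∀ i, D.Sat Φ₁ (π i)

end

/-- `D ⊨ Φ`: the initial state satisfies `Φ`. -/
def MarkovChain.Models {S AP : Type*} (D : MarkovChain S AP) (Φ : StateFormula AP) : Prop :=
  D.Sat Φ D.init

/-! ### The safe fragment -/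

/-- The Boolean combinations of atomic propositions. -/
inductive IsLiteralFormula {AP : Type*} : StateFormula AP → Prop
  | atom (a : AP) : IsLiteralFormula (.atom a)
  | not {Φ : StateFormula AP} : IsLiteralFormula Φ → IsLiteralFormula (.not Φ)
  | and {Φ₁ Φ₂ : StateFormula AP} :
      IsLiteralFormula Φ₁ → IsLiteralFormula Φ₂ → IsLiteralFormula (.and Φ₁ Φ₂)
  | or {Φ₁ Φ₂ : StateFormula AP} :
      IsLiteralFormula Φ₁ → IsLiteralFormula Φ₂ → IsLiteralFormula (.or Φ₁ Φ₂)

/-- The safe fragment of PCTL. Formulas are identified with their positive normal forms; the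
constructor `of_pnf` makes this explicit, so that in `untl` the formulas `¬ Φ₁` and `¬ Φ₂` may
be read in positive normal form. -/
inductive IsSafe {AP : Type*} : StateFormula AP → Prop
  | literal {Φ : StateFormula AP} : IsLiteralFormula Φ → IsSafe Φ
  | next {Φ : StateFormula AP} (q : unitInterval) :
      IsSafe Φ → IsSafe (.prob .ge q (.next Φ))
  | and {Φ₁ Φ₂ : StateFormula AP} : IsSafe Φ₁ → IsSafe Φ₂ → IsSafe (.and Φ₁ Φ₂)
  | or {Φ₁ Φ₂ : StateFormula AP} : IsSafe Φ₁ → IsSafe Φ₂ → IsSafe (.or Φ₁ Φ₂)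
  | wuntl {Φ₁ Φ₂ : StateFormula AP} (q : unitInterval) :
      IsSafe Φ₁ → IsSafe Φ₂ → IsSafe (.prob .ge q (.wuntl Φ₁ Φ₂))
  | untl {Φ₁ Φ₂ : StateFormula AP} (q : unitInterval) :
      IsSafe (.not Φ₁) → IsSafe (.not Φ₂) → IsSafe (.prob .le q (.untl Φ₁ Φ₂))
  | of_pnf {Φ : StateFormula AP} : IsSafe Φ.pnf → IsSafe Φ

/-! ### Probabilistic trees -/

/-- Probabilistic trees, with nodes in `N^*` (the standard choice is `N = ℕ`). The empty
sequence is not a node, and the root is the only node of length one. The edge labelling is a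
partial function to distributions on nodes; `prob π` is the zero function exactly at the leaves,
that is, where that partial function is undefined. -/
structure PTree (N : Type*) (AP : Type*) where
  nodes : Set (List N)
  nil_notMem : [] ∉ nodes
  prefix_closed : ∀ π ∈ nodes, ∀ π', π' <+: π → π' ≠ [] → π' ∈ nodes
  root : ∃! n, [n] ∈ nodes
  label : nodes → Set AP
  prob : nodes → nodes → ℝ≥0∞
  prob_pos_iff : ∀ π π' : nodes, 0 < prob π π' ↔ ∃ n, (π' : List N) = (π : List N) ++ [n]
  prob_sum : ∀ π : nodes, (∃ π', 0 < prob π π') → ∑' π', prob π π' = 1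

namespace PTree

variable {N N' AP : Type*}

/-- Every node has a proper extension. -/
def IsTotal (T : PTree N AP) : Prop :=
  ∀ π₁ ∈ T.nodes, ∃ π₂ ∈ T.nodes, π₁ <+: π₂ ∧ π₁ ≠ π₂

def IsFiniteDepth (T : PTree N AP) : Prop :=
  ∃ n : ℕ, ∀ π ∈ T.nodes, π.length ≤ n

/-- `T₁` is a restriction of `T₂` to a smaller set of nodes. -/
def IsPrefix (T₁ T₂ : PTree N AP) : Prop :=
  ∃ h : T₁.nodes ⊆ T₂.nodes,
    (∀ π : T₁.nodes, T₂.label ⟨π, h π.2⟩ = T₁.label π) ∧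
    (∀ π π' : T₁.nodes, T₂.prob ⟨π, h π.2⟩ ⟨π', h π'.2⟩ = T₁.prob π π')

/-- The set of the finite-depth prefixes of `T`. -/
def finPrefixes (T : PTree N AP) : Set (PTree N AP) :=
  {T₁ | T₁.IsFiniteDepth ∧ T₁.IsPrefix T}

/-- Isomorphism of probabilistic trees: they are the same up to the names of the nodes.
(As edges are the pairs of positive probability, edges and the root are preserved, too.) -/
def Isomorphic (T : PTree N AP) (T' : PTree N' AP) : Prop :=
  ∃ e : T.nodes ≃ T'.nodes,
    (∀ π, T'.label (e π) = T.label π) ∧ (∀ π π', T'.prob (e π) (e π') = T.prob π π')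

end PTree

/-! ### Unfoldings of Markov chains -/

namespace MarkovChain

variable {S AP : Type*}

/-- The nodes of the unfolding. -/
inductive Node (D : MarkovChain S AP) : List S → Prop
  | init : Node D [D.init]
  | step {π : List S} {s t : S} :
      Node D (π ++ [s]) → t ∈ (D.step s).support → Node D (π ++ [s] ++ [t])

theorem Node.ne_nil {D : MarkovChain S AP} {π : List S} (h : D.Node π) : π ≠ [] := by
  cases h <;> simp

/-- The last state of a node. -/
def Node.last {D : MarkovChain S AP} (π : {π : List S // D.Node π}) : S :=
  π.1.getLast π.2.ne_nil

theorem Node.append {D : MarkovChain S AP} {π : List S} (h : D.Node π) {t : S}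
    (ht : t ∈ (D.step (π.getLast h.ne_nil)).support) : D.Node (π ++ [t]) := by
  have h' := List.dropLast_append_getLast h.ne_nil
  have := Node.step (D := D) (π := π.dropLast) (s := π.getLast h.ne_nil) (t := t)
    (by rwa [h']) ht
  rwa [h'] at this

theorem Node.mem_support {D : MarkovChain S AP} {π : List S} (hπ : D.Node π) {t : S}
    (h : D.Node (π ++ [t])) : t ∈ (D.step (π.getLast hπ.ne_nil)).support := by
  generalize hρ : π ++ [t] = ρ at h
  cases h with
  | init => exact absurd (by simpa using congrArg List.length hρ) hπ.ne_nil
  | step h ht =>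
    obtain ⟨rfl, h2⟩ := List.append_inj' hρ rfl
    obtain rfl : t = _ := by simpa using h2
    simpa using ht

theorem Node.of_prefix {D : MarkovChain S AP} {π : List S} (h : D.Node π) :
    ∀ π', π' <+: π → π' ≠ [] → D.Node π' := by
  induction h with
  | init =>
    intro π' h h0
    have h1 : π'.length = 1 :=
      le_antisymm (by simpa using h.length_le) (List.length_pos_iff.2 h0)
    rw [h.eq_of_length (by simpa using h1)]
    exact Node.init
  | step h ht ih =>
    intro π' h' h0
    rcases List.prefix_concat_iff.1 h' with rfl | h''
    · exact Node.step h ht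
    · exact ih π' h'' h0

theorem Node.eq_init {D : MarkovChain S AP} {s : S} (h : D.Node [s]) : s = D.init := by
  generalize hρ : [s] = ρ at h
  cases h with
  | init => simpa using hρ
  | step h ht => simpa using congrArg List.length hρ

open Classical in
/-- The unfolding of a Markov chain. -/
noncomputable def unfolding (D : MarkovChain S AP) : PTree S AP where
  nodes := {π | D.Node π}
  nil_notMem h := h.ne_nil rfl
  prefix_closed _ h := Node.of_prefix h
  root := ⟨D.init, Node.init, fun _ h => Node.eq_init h⟩
  label π := D.label (Node.last π)
  prob π π' := if ∃ t, π'.1 = π.1 ++ [t] then D.step (Node.last π) (Node.last π') else 0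
  prob_pos_iff := by
    intro π π'
    split_ifs with h
    · refine iff_of_true ?_ h
      obtain ⟨t, ht⟩ := h
      have h2 := Node.mem_support π.2 (ht ▸ π'.2)
      have h3 : Node.last π' = t := by simp [Node.last, ht]
      rw [h3]
      exact pos_iff_ne_zero.2 ((PMF.mem_support_iff _ _).1 h2)
    · exact iff_of_false (lt_irrefl _) h
  prob_sum := by
    intro π _
    let c : (D.step (Node.last π)).support → {π | D.Node π} := fun t =>
      ⟨π.1 ++ [t.1], Node.append π.2 t.2⟩
    have hc : Function.Injective c := by
      intro s t h
      simpa [c, Subtype.ext_iff] using h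
    rw [← (D.step (Node.last π)).tsum_coe, ← hc.tsum_eq]
    · rw [← tsum_subtype_eq_of_support_subset (f := fun a => D.step (Node.last π) a)
        (s := (D.step (Node.last π)).support) subset_rfl]
      refine tsum_congr fun t => ?_
      simp [c, Node.last]
    · intro π' h
      simp only [Function.mem_support, ne_eq, ite_eq_right_iff, not_forall] at h
      obtain ⟨⟨t, ht⟩, -⟩ := h
      refine ⟨⟨t, Node.mem_support π.2 (ht ▸ π'.2)⟩, ?_⟩
      exact Subtype.ext ht.symm

end MarkovChain

/-! ### Properties and safety -/

/-- A set of total probabilistic trees `P` is a safety property if a total tree belongs to `P`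
exactly when all its finite-depth prefixes extend to members of `P`. -/
def IsSafetyProperty {AP : Type*} (P : Set (PTree ℕ AP)) : Prop :=
  (∀ T ∈ P, T.IsTotal) ∧
  ∀ T : PTree ℕ AP, T.IsTotal →
    (T ∈ P ↔ ∀ T₁ ∈ T.finPrefixes, ∃ T₂ ∈ P, T₁.IsPrefix T₂)

/-- The set of the unfoldings of the Markov chains with state space `ℕ` that satisfy `Φ`. -/
def unfoldingProperty {AP : Type*} (Φ : StateFormula AP) : Set (PTree ℕ AP) :=
  {T | ∃ D : MarkovChain ℕ AP, D.Models Φ ∧ T = D.unfolding}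

/-- The set of the trees that are, up to the names of the nodes, unfoldings of
Markov chains (with an arbitrary countable state space) that satisfy `Φ`. -/
def treeProperty {AP : Type*} (Φ : StateFormula AP) : Set (PTree ℕ AP) :=
  {T | ∃ (S : Type) (_ : Countable S) (D : MarkovChain S AP),
    D.Models Φ ∧ D.unfolding.Isomorphic T}

end PCTL

-- Only one direction has content, since a member of the property extends all of its own prefixes.
-- The other rests on a closedness principle, `IsSafe.passesToLimit`: if chains `D' n` agree with
-- `D` below a state to depths that tend to infinity, and a safe formula holds in infinitely many
-- `D' n`, then it holds in `D`.
--
-- The principle is proved by induction on the formula, for predicates `A` on `D` and `A' n` on `D'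
-- n`. Cutting formulas at a finite depth would not do, because nested weak untils look at the whole
-- tree. What is needed is upper semicontinuity of path probabilities. `A W B` is a decreasing
-- intersection of finite-horizon events whose probabilities satisfy a one-step recursion; reverse
-- Fatou for sums against a fixed distribution bounds the limsup at each horizon, and continuity
-- from above removes the horizon. A bound `≤ q` on an until is a bound `≥ 1 - q` on a weak until of
-- the negated formulas, so it is covered as well.
--
-- Let all finite-depth prefixes of a total tree `T` extend to members. The truncations of `T` then
-- embed in unfoldings of chains `D' n` satisfying `Φ`. Up to isomorphism, `T` is the unfolding of
-- the chain on its own nodes, which the `D' n` approximate. For literal unfoldings a chain on `ℕ`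
-- is glued together: nodes with the same last entry lie in a common truncation, so their labels and
-- transitions agree.

namespace PCTL

/-! ### Trajectories of a time-homogeneous kernel -/

section Trajectory

/-- The paths that agree with `x` up to time `n`. -/
def cylinder {S : Type*} (x : ℕ → S) (n : ℕ) : Set (ℕ → S) := {π | ∀ i ≤ n, π i = x i}

theorem cylinder_eq_preimage {S : Type*} (x : ℕ → S) (n : ℕ) :
    cylinder x n = Preorder.frestrictLe (π := fun _ => S) n ⁻¹'
      {fun i : Finset.Iic n => x i} := by
  ext π
  simp [cylinder, funext_iff, Preorder.frestrictLe]

/-- Prepend a state to a path. -/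
def cons {S : Type*} (s : S) (π : ℕ → S) : ℕ → S
  | 0 => s
  | n + 1 => π n

variable {S : Type*} [MeasurableSpace S]

theorem measurable_cons (s : S) : Measurable (cons s) :=
  measurable_pi_lambda _ fun n => by
    cases n
    · exact measurable_const
    · exact measurable_pi_apply _

/-- The law of the trajectory of a time-homogeneous Markov kernel, as a kernel in the
starting point. -/
noncomputable def trajectory (κ : Kernel S S) [IsMarkovKernel κ] : Kernel S (ℕ → S) :=
  (Kernel.traj (X := fun _ => S)
    (fun n => κ.comap
      (fun x : (i : Finset.Iic n) → S => x ⟨n, Finset.mem_Iic.2 le_rfl⟩) (measurable_pi_apply _))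
    0).comap (fun s _ => s) (by fun_prop)

instance (κ : Kernel S S) [IsMarkovKernel κ] : IsMarkovKernel (trajectory κ) := by
  unfold trajectory; infer_instance

variable [MeasurableSingletonClass S]

theorem measurableSet_cylinder (x : ℕ → S) (n : ℕ) : MeasurableSet (cylinder x n) := by
  rw [cylinder_eq_preimage]
  exact Preorder.measurable_frestrictLe n (measurableSet_singleton _)

theorem trajectory_cylinder_zero (κ : Kernel S S) [IsMarkovKernel κ] (s : S) (x : ℕ → S) :
    trajectory κ s (cylinder x 0) = Set.indicator {x 0} 1 s := by
  rw [cylinder_eq_preimage, ← Measure.map_apply (Preorder.measurable_frestrictLe 0)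
    (measurableSet_singleton _)]
  rw [trajectory, Kernel.comap_apply, Kernel.traj_map_frestrictLe_apply, Kernel.partialTraj_self,
    Kernel.id_apply, Measure.dirac_apply' _ (measurableSet_singleton _)]
  have : ((fun _ => s) = fun i : Finset.Iic 0 => x i) ↔ s = x 0 := by
    constructor
    · intro h
      exact congrFun h ⟨0, by simp⟩
    · rintro rfl
      ext ⟨i, hi⟩
      obtain rfl : i = 0 := by simpa using hi
      rfl
  by_cases h : s = x 0
  · rw [Set.indicator_of_mem (Set.mem_singleton_iff.2 (this.2 h)), Set.indicator_of_mem (Set.mem_singleton_iff.2 h)]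
    rfl
  · rw [Set.indicator_of_notMem (fun h' => h (this.1 (Set.mem_singleton_iff.1 h'))), Set.indicator_of_notMem (by simpa using h)]

/-- The joint law of the first coordinates and the next one is a composition product with `κ`, here
evaluated on a product of singletons. -/
theorem trajectory_cylinder_succ (κ : Kernel S S) [IsMarkovKernel κ] (s : S) (x : ℕ → S) (n : ℕ) :
    trajectory κ s (cylinder x (n + 1)) =
      trajectory κ s (cylinder x n) * κ (x n) {x (n + 1)} := by
  have h := Kernel.partialTraj_compProd_eq_map_traj (X := fun _ => S)
    (κ := fun n => κ.comap
      (fun x : (i : Finset.Iic n) → S => x ⟨n, Finset.mem_Iic.2 le_rfl⟩) (measurable_pi_apply _))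
    (Nat.zero_le n) (x₀ := fun _ => s)
  have h1 : cylinder x (n + 1) =
      (fun π : ℕ → S => (Preorder.frestrictLe (π := fun _ => S) n π, π (n + 1))) ⁻¹'
        ({fun i : Finset.Iic n => x i} ×ˢ {x (n + 1)}) := by
    ext π
    simp only [cylinder, Set.mem_ofPred_eq, Set.mem_preimage, Set.mem_prod, Set.mem_singleton_iff,
      funext_iff, Preorder.frestrictLe_apply, Subtype.forall, Finset.mem_Iic]
    exact ⟨fun h => ⟨fun i hi => h i (by omega), h _ le_rfl⟩, fun h i hi => by
      rcases Nat.le_succ_iff.1 hi with h' | rfl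
      exacts [h.1 i h', h.2]⟩
  rw [h1, ← Measure.map_apply (by fun_prop)
    ((measurableSet_singleton _).prod (measurableSet_singleton _)), trajectory,
    Kernel.comap_apply, ← h, Measure.compProd_apply_prod (measurableSet_singleton _)
    (measurableSet_singleton _), lintegral_singleton, Kernel.comap_apply, mul_comm,
    cylinder_eq_preimage, ← Measure.map_apply (Preorder.measurable_frestrictLe n)
    (measurableSet_singleton _), Kernel.traj_map_frestrictLe_apply]

/-- The construction of the measure appends steps at the end; this splits off the first step
instead, as the recursion for weak until requires. -/
theorem trajectory_cylinder_succ' (κ : Kernel S S) [IsMarkovKernel κ] (s : S) (x : ℕ → S) (n : ℕ) :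
    trajectory κ s (cylinder x (n + 1)) =
      Set.indicator {x 0} 1 s *
        (κ (x 0) {x 1} * trajectory κ (x 1) (cylinder (fun i => x (i + 1)) n)) := by
  induction n with
  | zero => simp [trajectory_cylinder_succ, trajectory_cylinder_zero]
  | succ n ih => rw [trajectory_cylinder_succ, ih, trajectory_cylinder_succ]; ring

theorem trajectory_start (κ : Kernel S S) [IsMarkovKernel κ] (s : S) :
    ∀ᵐ π ∂trajectory κ s, π 0 = s := by
  have h : trajectory κ s (cylinder (fun _ => s) 0) = 1 := by
    simp [trajectory_cylinder_zero]
  have h2 := (prob_compl_eq_zero_iff (μ := trajectory κ s)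
    (measurableSet_cylinder (fun _ => s) 0)).2 h
  rw [ae_iff]
  convert h2 using 2
  ext π
  simp [cylinder]

variable [Countable S]

/-- Cylinders give the point masses of the marginals on initial segments, which live on countable
spaces. Every finite index set lies in an initial segment, so uniqueness of projective limits
applies. -/
theorem measure_ext_of_cylinder {μ ν : Measure (ℕ → S)} [IsFiniteMeasure μ]
    (h : ∀ x n, μ (cylinder x n) = ν (cylinder x n)) : μ = ν := by
  have key : ∀ n, μ.map (Preorder.frestrictLe (π := fun _ => S) n) =
      ν.map (Preorder.frestrictLe (π := fun _ => S) n) := by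
    intro n
    refine Measure.ext_of_singleton fun y => ?_
    rw [Measure.map_apply (Preorder.measurable_frestrictLe n) (measurableSet_singleton _),
      Measure.map_apply (Preorder.measurable_frestrictLe n) (measurableSet_singleton _)]
    -- The finite word `y` is extended to a path by freezing it at time `n`.
    have := h (fun i => y ⟨min i n, by simp⟩) n
    rw [cylinder_eq_preimage] at this
    convert this using 4 <;>
    · ext i
      congr 1
      exact Subtype.ext (min_eq_left (Finset.mem_Iic.1 i.2)).symm
  refine IsProjectiveLimit.unique (P := fun I : Finset ℕ => μ.map I.restrict) (fun I => rfl)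
    fun I => ?_
  have hI : I ⊆ Finset.Iic (I.sup id) := fun i hi =>
    Finset.mem_Iic.2 (Finset.le_sup (f := id) hi)
  have h1 : (I.restrict : (ℕ → S) → _) = Finset.restrict₂ (π := fun _ => S) hI ∘
      Preorder.frestrictLe (π := fun _ => S) (I.sup id) := rfl
  change ν.map I.restrict = μ.map I.restrict
  rw [h1, ← Measure.map_map (by fun_prop) (by fun_prop),
    ← Measure.map_map (by fun_prop) (by fun_prop), key]

theorem trajectory_eq_map_cons (κ : Kernel S S) [IsMarkovKernel κ] (s : S) :
    trajectory κ s = ((κ s).bind (trajectory κ)).map (cons s) := by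
  refine measure_ext_of_cylinder fun x n => ?_
  rw [Measure.map_apply (measurable_cons s) (measurableSet_cylinder _ _)]
  cases n with
  | zero =>
    rw [trajectory_cylinder_zero]
    by_cases h : s = x 0
    · have : cons s ⁻¹' cylinder x 0 = Set.univ := by
        ext π; simp [cylinder, cons, h]
      rw [this, measure_univ]
      simp [h]
    · have : cons s ⁻¹' cylinder x 0 = ∅ := by
        ext π; simp [cylinder, cons, h]
      simp [this, h]
  | succ n =>
    rw [trajectory_cylinder_succ']
    by_cases h : s = x 0
    · have : cons s ⁻¹' cylinder x (n + 1) = cylinder (fun i => x (i + 1)) n := by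
        ext π
        simp only [cylinder, Set.mem_preimage, Set.mem_ofPred_eq]
        refine ⟨fun h' i hi => h' (i + 1) (by omega), fun h' i hi => ?_⟩
        cases i with
        | zero => exact h
        | succ i => exact h' i (by omega)
      -- Only `t = x 1` contributes: from any other start the cylinder is null.
      have h0 : ∀ t, trajectory κ t (cylinder (fun i => x (i + 1)) n) =
          Set.indicator {x 1}
            (fun _ => trajectory κ (x 1) (cylinder (fun i => x (i + 1)) n)) t := by
        intro t
        by_cases ht : t = x 1
        · simp [ht]
        · have : trajectory κ t (cylinder (fun i => x (i + 1)) 0) = 0 := by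
            simp [trajectory_cylinder_zero, ht]
          rw [Set.indicator_of_notMem (by simpa using ht)]
          exact measure_mono_null (t := cylinder _ 0) (fun π hπ i hi => hπ i (by omega)) this
      rw [this, Measure.bind_apply (measurableSet_cylinder _ _) (trajectory κ).aemeasurable]
      rw [lintegral_congr h0, lintegral_indicator_const (measurableSet_singleton _)]
      simp [h, mul_comm]
    · have : cons s ⁻¹' cylinder x (n + 1) = ∅ := by
        ext π
        simp only [cylinder, Set.mem_preimage, Set.mem_ofPred_eq, Set.mem_empty_iff_false, iff_false]
        exact fun h' => h (h' 0 (by omega))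
      simp [this, h]

/-- First-step decomposition of the law of a trajectory. -/
theorem trajectory_apply (κ : Kernel S S) [IsMarkovKernel κ] (s : S) {E : Set (ℕ → S)}
    (hE : MeasurableSet E) :
    trajectory κ s E = ∫⁻ t, trajectory κ t (cons s ⁻¹' E) ∂κ s := by
  conv_lhs => rw [trajectory_eq_map_cons, Measure.map_apply (measurable_cons s) hE]
  rw [Measure.bind_apply (measurable_cons s hE) (trajectory κ).aemeasurable]

end Trajectory

/-! ### Weak until as a limit of finite-horizon events -/

/-- The paths that satisfy `A W B`. -/
def weakUntil {S : Type*} (A B : S → Prop) : Set (ℕ → S) :=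
  {π | (∃ j, B (π j) ∧ ∀ k < j, A (π k)) ∨ ∀ i, A (π i)}

/-- The paths that satisfy `A W B` as far as the first `m` states can tell. -/
def weakUntilUpTo {S : Type*} (A B : S → Prop) : ℕ → Set (ℕ → S)
  | 0 => Set.univ
  | m + 1 => {π | B (π 0) ∨ A (π 0) ∧ (fun i => π (i + 1)) ∈ weakUntilUpTo A B m}

theorem mem_weakUntil_iff {S : Type*} {A B : S → Prop} {π : ℕ → S} :
    π ∈ weakUntil A B ↔ B (π 0) ∨ A (π 0) ∧ (fun i => π (i + 1)) ∈ weakUntil A B := by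
  constructor
  · rintro (⟨j, hB, hA⟩ | h)
    · cases j with
      | zero => exact .inl hB
      | succ j => exact .inr ⟨hA 0 (by omega), .inl ⟨j, hB, fun k hk => hA (k + 1) (by omega)⟩⟩
    · exact .inr ⟨h 0, .inr fun i => h (i + 1)⟩
  · rintro (h | ⟨h0, ⟨j, hB, hA⟩ | h⟩)
    · exact .inl ⟨0, h, by simp⟩
    · refine .inl ⟨j + 1, hB, fun k hk => ?_⟩
      cases k with
      | zero => exact h0
      | succ k => exact hA k (by omega)
    · refine .inr fun i => ?_
      cases i with
      | zero => exact h0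
      | succ i => exact h i

theorem weakUntil_eq_iInter {S : Type*} (A B : S → Prop) :
    weakUntil A B = ⋂ m, weakUntilUpTo A B m := by
  ext π
  rw [Set.mem_iInter]
  constructor
  · intro h m
    induction m generalizing π with
    | zero => trivial
    | succ m ih => exact (mem_weakUntil_iff.1 h).imp_right fun h' => ⟨h'.1, ih _ h'.2⟩
  · intro h
    by_contra hn
    -- If the path violates `A W B`, then `B` fails at every position reached through `A`, so the
    -- finite-horizon events force `A` once more and pass to the shifted path.
    have key : ∀ i, (∀ k < i, A (π k)) ∧ ∀ m, (fun j => π (j + i)) ∈ weakUntilUpTo A B m := by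
      intro i
      induction i with
      | zero => exact ⟨by simp, h⟩
      | succ i ih =>
        have hB : ¬ B (π i) := fun hB => hn (.inl ⟨i, hB, ih.1⟩)
        have h' : ∀ m, A (π i) ∧ (fun j => π (j + 1 + i)) ∈ weakUntilUpTo A B m := fun m => by
          have := ih.2 (m + 1)
          simp only [weakUntilUpTo, Set.mem_ofPred_eq, zero_add] at this
          exact this.resolve_left hB
        refine ⟨fun k hk => ?_, fun m => ?_⟩
        · rcases Nat.lt_succ_iff_lt_or_eq.1 hk with h1 | rfl
          exacts [ih.1 k h1, (h' 0).1]
        · have := (h' m).2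
          simpa only [add_assoc, add_comm 1 i] using this
    exact hn (.inr fun i => (key (i + 1)).1 i (by omega))

theorem antitone_weakUntilUpTo {S : Type*} (A B : S → Prop) : Antitone (weakUntilUpTo A B) := by
  refine antitone_nat_of_succ_le fun m => ?_
  induction m with
  | zero => exact Set.subset_univ _
  | succ m ih => exact fun π h => h.imp_right fun h' => ⟨h'.1, ih h'.2⟩

-- Measurability and probability of weak until.

section WeakUntilMeasure

variable {S : Type*} [MeasurableSpace S] [DiscreteMeasurableSpace S]

theorem measurableSet_weakUntilUpTo (A B : S → Prop) (m : ℕ) :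
    MeasurableSet (weakUntilUpTo A B m) := by
  induction m with
  | zero => exact MeasurableSet.univ
  | succ m ih =>
    have h : ∀ C : S → Prop, MeasurableSet {π : ℕ → S | C (π 0)} := fun C =>
      measurable_pi_apply 0 (MeasurableSet.of_discrete (s := {s | C s}))
    exact (h B).union ((h A).inter (measurable_pi_lambda _ (fun i => measurable_pi_apply _) ih))

theorem measurableSet_weakUntil (A B : S → Prop) : MeasurableSet (weakUntil A B) := by
  rw [weakUntil_eq_iInter]
  exact MeasurableSet.iInter fun m => measurableSet_weakUntilUpTo A B m

theorem measure_weakUntil (μ : Measure (ℕ → S)) [IsFiniteMeasure μ] (A B : S → Prop) :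
    μ (weakUntil A B) = ⨅ m, μ (weakUntilUpTo A B m) := by
  rw [weakUntil_eq_iInter, (antitone_weakUntilUpTo A B).measure_iInter
    (fun m => (measurableSet_weakUntilUpTo A B m).nullMeasurableSet) ⟨0, measure_ne_top _ _⟩]

variable [Countable S] (κ : Kernel S S) [IsMarkovKernel κ]

open Classical in
theorem trajectory_weakUntilUpTo_succ (A B : S → Prop) (m : ℕ) (s : S) :
    trajectory κ s (weakUntilUpTo A B (m + 1)) =
      if B s then 1 else if A s then ∫⁻ t, trajectory κ t (weakUntilUpTo A B m) ∂κ s else 0 := by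
  rw [trajectory_apply κ s (measurableSet_weakUntilUpTo A B (m + 1))]
  split_ifs with hB hA
  · have : cons s ⁻¹' weakUntilUpTo A B (m + 1) = Set.univ := by
      ext π; simp [weakUntilUpTo, cons, hB]
    simp [this]
  · have : cons s ⁻¹' weakUntilUpTo A B (m + 1) = weakUntilUpTo A B m := by
      ext π; simp [weakUntilUpTo, cons, hB, hA]
    simp [this]
  · have : cons s ⁻¹' weakUntilUpTo A B (m + 1) = ∅ := by
      ext π; simp [weakUntilUpTo, cons, hB, hA]
    simp [this]

theorem trajectory_next (A : S → Prop) (s : S) :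
    trajectory κ s {π | A (π 1)} = κ s {t | A t} := by
  have hm : ∀ n, MeasurableSet {π : ℕ → S | A (π n)} := fun n =>
    measurable_pi_apply n (MeasurableSet.of_discrete (s := {s | A s}))
  rw [trajectory_apply κ s (hm 1)]
  have h : ∀ t, trajectory κ t (cons s ⁻¹' {π | A (π 1)}) = Set.indicator {t | A t} 1 t := by
    intro t
    have h0 : cons s ⁻¹' {π | A (π 1)} = {π | A (π 0)} := rfl
    rw [h0]
    have h1 : ({π : ℕ → S | A (π 0)} : Set _) =ᵐ[trajectory κ t] {_π | A t} := by
      filter_upwards [trajectory_start κ t] with π hπ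
      exact congrArg A hπ
    rw [measure_congr h1]
    by_cases ht : A t <;> simp [ht]
  simp_rw [h]
  exact lintegral_indicator_one MeasurableSet.of_discrete

end WeakUntilMeasure

open Filter Topology

/-! ### Path probabilities in a Markov chain -/

namespace MarkovChain

variable {S AP : Type*} (D : MarkovChain S AP)

/-- `pathMeasure` is definitionally `trajectory` of the step kernel for the discrete `σ`-algebra, so
the general results transfer directly. -/
theorem isProbabilityMeasure_pathMeasure (s : S) :
    @IsProbabilityMeasure _ (pathSpace S) (D.pathMeasure s) :=
  let _ : MeasurableSpace S := ⊤
  inferInstanceAs (IsProbabilityMeasure (trajectory D.stepKernel s))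

theorem pathMeasure_le_one (s : S) (E : Set (ℕ → S)) : D.pathMeasure s E ≤ 1 :=
  let _ : MeasurableSpace S := ⊤
  have := D.isProbabilityMeasure_pathMeasure s
  prob_le_one

theorem lintegral_stepKernel [Countable S] (s : S) (g : S → ℝ≥0∞) :
    ∫⁻ t, g t ∂(@DFunLike.coe (@Kernel S S ⊤ ⊤) S (fun _ => @Measure S ⊤) _ D.stepKernel s) =
      ∑' t, D.step s t * g t := by
  let _ : MeasurableSpace S := ⊤
  rw [lintegral_countable']
  refine tsum_congr fun t => ?_
  rw [mul_comm]
  congr 1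
  exact PMF.toMeasure_apply_singleton _ _ MeasurableSpace.measurableSet_top

theorem pathMeasure_weakUntil (A B : S → Prop) (s : S) :
    D.pathMeasure s (weakUntil A B) = ⨅ m, D.pathMeasure s (weakUntilUpTo A B m) :=
  let _ : MeasurableSpace S := ⊤
  have := D.isProbabilityMeasure_pathMeasure s
  measure_weakUntil _ A B

variable [Countable S]

theorem pathMeasure_start (s : S) (E : Set (ℕ → S)) :
    D.pathMeasure s {π | π 0 = s ∧ π ∈ E} = D.pathMeasure s E := by
  let _ : MeasurableSpace S := ⊤
  refine measure_congr ?_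
  filter_upwards [trajectory_start D.stepKernel s] with π hπ
  exact propext (and_iff_right hπ)

theorem pathMeasure_next (s : S) (A : S → Prop) :
    D.pathMeasure s {π | A (π 1)} = ∑' t, D.step s t * Set.indicator {t | A t} 1 t := by
  let _ : MeasurableSpace S := ⊤
  rw [← lintegral_stepKernel, lintegral_indicator_one MeasurableSpace.measurableSet_top]
  exact trajectory_next D.stepKernel A s

open Classical in
theorem pathMeasure_weakUntilUpTo_succ (A B : S → Prop) (m : ℕ) (s : S) :
    D.pathMeasure s (weakUntilUpTo A B (m + 1)) =
      if B s then 1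
      else if A s then ∑' t, D.step s t * D.pathMeasure t (weakUntilUpTo A B m) else 0 := by
  let _ : MeasurableSpace S := ⊤
  rw [← lintegral_stepKernel]
  exact trajectory_weakUntilUpTo_succ D.stepKernel A B m s

/-- `A U B` is the complement of `¬ B W (¬ A ∧ ¬ B)`. -/
theorem until_eq_compl_weakUntil {S : Type*} (A B : S → Prop) :
    {π : ℕ → S | ∃ j, B (π j) ∧ ∀ k < j, A (π k)} =
      (weakUntil (fun s => ¬ B s) (fun s => ¬ A s ∧ ¬ B s))ᶜ := by
  ext π
  constructor
  · rintro ⟨j, hB, hA⟩ (⟨i, ⟨hA', hB'⟩, h⟩ | h)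
    · rcases lt_trichotomy i j with hij | rfl | hij
      exacts [hA' (hA i hij), hB' hB, h j hij hB]
    · exact h j hB
  · intro h
    simp only [weakUntil, Set.mem_compl_iff, Set.mem_ofPred_eq, not_or, not_exists, not_and,
      not_forall, not_not] at h
    obtain ⟨h1, h2⟩ := h
    classical
    refine ⟨Nat.find h2, Nat.find_spec h2, fun k => ?_⟩
    intro hk
    by_contra hA
    obtain ⟨l, hl, hB⟩ := h1 k ⟨hA, Nat.find_min h2 hk⟩
    exact Nat.find_min h2 (hl.trans hk) hB

theorem sat_next_iff (q : unitInterval) (Φ : StateFormula AP) (s : S) :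
    D.Sat (.prob .ge q (.next Φ)) s ↔
      ENNReal.ofReal q ≤ ∑' t, D.step s t * Set.indicator {t | D.Sat Φ t} 1 t := by
  rw [← pathMeasure_next, ← pathMeasure_start, ENNReal.ofReal_le_iff_le_toReal
    (ne_top_of_le_ne_top ENNReal.one_ne_top (D.pathMeasure_le_one _ _)), MarkovChain.Sat]
  simp only [MarkovChain.PathSat]
  rfl

theorem sat_wuntl_iff (q : unitInterval) (Φ₁ Φ₂ : StateFormula AP) (s : S) :
    D.Sat (.prob .ge q (.wuntl Φ₁ Φ₂)) s ↔
      ENNReal.ofReal q ≤ D.pathMeasure s (weakUntil (D.Sat Φ₁) (D.Sat Φ₂)) := by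
  rw [← pathMeasure_start, ENNReal.ofReal_le_iff_le_toReal
    (ne_top_of_le_ne_top ENNReal.one_ne_top (D.pathMeasure_le_one _ _)), MarkovChain.Sat]
  simp only [MarkovChain.PathSat]
  rfl

/-- Passing to the complement puts the upper bound on until into the same form as `sat_wuntl_iff`,
with operands built from the negations that `IsSafe.untl` assumes to be safe. -/
theorem sat_untl_iff (q : unitInterval) (Φ₁ Φ₂ : StateFormula AP) (s : S) :
    D.Sat (.prob .le q (.untl Φ₁ Φ₂)) s ↔
      ENNReal.ofReal (1 - q) ≤ D.pathMeasure s
        (weakUntil (fun t => ¬ D.Sat Φ₂ t) (fun t => ¬ D.Sat Φ₁ t ∧ ¬ D.Sat Φ₂ t)) := by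
  have h : D.Sat (.prob .le q (.untl Φ₁ Φ₂)) s ↔
      (D.pathMeasure s {π | π 0 = s ∧
        π ∈ {π : ℕ → S | ∃ j, D.Sat Φ₂ (π j) ∧ ∀ k < j, D.Sat Φ₁ (π k)}}).toReal ≤ q := by
    rw [MarkovChain.Sat]
    simp only [MarkovChain.PathSat]
    rfl
  rw [h, pathMeasure_start, until_eq_compl_weakUntil]
  let _ : MeasurableSpace S := ⊤
  have := D.isProbabilityMeasure_pathMeasure s
  rw [ENNReal.ofReal_le_iff_le_toReal (measure_ne_top _ _),
    prob_compl_eq_one_sub (measurableSet_weakUntil _ _),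
    ENNReal.toReal_sub_of_le prob_le_one ENNReal.one_ne_top, ENNReal.toReal_one]
  exact sub_le_comm

end MarkovChain

/-! ### Positive normal forms -/

theorem Comparison.compl_holds (c : Comparison) (p q : ℝ) : c.compl.Holds p q ↔ ¬ c.Holds p q := by
  cases c <;> simp [Comparison.compl, Comparison.Holds]

section PositiveNormalForm

variable {S AP : Type*} (D : MarkovChain S AP)

mutual

theorem MarkovChain.sat_pnf : ∀ (Φ : StateFormula AP) (s : S), D.Sat Φ.pnf s ↔ D.Sat Φ s
  | .atom a, s => by rw [StateFormula.pnf]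
  | .and Φ₁ Φ₂, s => by
    simp only [StateFormula.pnf, MarkovChain.Sat, MarkovChain.sat_pnf Φ₁, MarkovChain.sat_pnf Φ₂]
  | .or Φ₁ Φ₂, s => by
    simp only [StateFormula.pnf, MarkovChain.Sat, MarkovChain.sat_pnf Φ₁, MarkovChain.sat_pnf Φ₂]
  | .not Φ, s => by
    simp only [StateFormula.pnf, MarkovChain.Sat, MarkovChain.sat_pnfNeg Φ]
  | .prob c q φ, s => by
    simp only [StateFormula.pnf, MarkovChain.Sat, MarkovChain.pathSat_pnf φ]

theorem MarkovChain.sat_pnfNeg : ∀ (Φ : StateFormula AP) (s : S), D.Sat Φ.pnfNeg s ↔ ¬ D.Sat Φ s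
  | .atom a, s => by simp only [StateFormula.pnfNeg, MarkovChain.Sat]
  | .and Φ₁ Φ₂, s => by
    simp only [StateFormula.pnfNeg, MarkovChain.Sat, MarkovChain.sat_pnfNeg Φ₁,
      MarkovChain.sat_pnfNeg Φ₂, not_and_or]
  | .or Φ₁ Φ₂, s => by
    simp only [StateFormula.pnfNeg, MarkovChain.Sat, MarkovChain.sat_pnfNeg Φ₁,
      MarkovChain.sat_pnfNeg Φ₂, not_or]
  | .not Φ, s => by
    simp only [StateFormula.pnfNeg, MarkovChain.Sat, MarkovChain.sat_pnf Φ, not_not]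
  | .prob c q φ, s => by
    simp only [StateFormula.pnfNeg, MarkovChain.Sat, MarkovChain.pathSat_pnf φ,
      Comparison.compl_holds]

theorem MarkovChain.pathSat_pnf :
    ∀ (φ : PathFormula AP) (π : ℕ → S), D.PathSat φ.pnf π ↔ D.PathSat φ π
  | .next Φ, π => by
    simp only [PathFormula.pnf, MarkovChain.PathSat, MarkovChain.sat_pnf Φ]
  | .untl Φ₁ Φ₂, π => by
    simp only [PathFormula.pnf, MarkovChain.PathSat, MarkovChain.sat_pnf Φ₁,
      MarkovChain.sat_pnf Φ₂]
  | .wuntl Φ₁ Φ₂, π => by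
    simp only [PathFormula.pnf, MarkovChain.PathSat, MarkovChain.sat_pnf Φ₁,
      MarkovChain.sat_pnf Φ₂]

end

end PositiveNormalForm

theorem IsLiteralFormula.sat_congr {S S' AP : Type*} {D : MarkovChain S AP}
    {D' : MarkovChain S' AP} {Φ : StateFormula AP} (hΦ : IsLiteralFormula Φ) {s : S} {s' : S'}
    (h : D'.label s' = D.label s) : D'.Sat Φ s' ↔ D.Sat Φ s := by
  induction hΦ with
  | atom a => simp only [MarkovChain.Sat, h]
  | not _ ih => simp only [MarkovChain.Sat, ih]
  | and _ _ ih₁ ih₂ => simp only [MarkovChain.Sat, ih₁, ih₂]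
  | or _ _ ih₁ ih₂ => simp only [MarkovChain.Sat, ih₁, ih₂]

/-! ### Approximation of a chain by chains that agree with it up to a finite depth -/

/-- `f` is a morphism of chains on the part of `D` that is reachable from a state in less than
the given number of steps. -/
def LocalMorphism {S S' AP : Type*} (D : MarkovChain S AP) (D' : MarkovChain S' AP) (f : S → S') :
    ℕ → S → Prop
  | 0, _ => True
  | k + 1, s => D'.label (f s) = D.label s ∧ D'.step (f s) = (D.step s).map f ∧
      ∀ t ∈ (D.step s).support, LocalMorphism D D' f k t

theorem tsum_map_mul {α β : Type*} (p : PMF α) (f : α → β) (g : β → ℝ≥0∞) :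
    ∑' b, p.map f b * g b = ∑' a, p a * g (f a) := by
  classical
  simp_rw [PMF.map_apply, ← ENNReal.tsum_mul_right]
  rw [ENNReal.tsum_comm]
  refine tsum_congr fun a => ?_
  rw [tsum_eq_single (f a)]
  · simp
  · intro b hb
    simp [hb]

/-- Reverse Fatou for the counting measure; the summable function `p` dominates. -/
theorem limsup_tsum_mul_le {α : Type*} (p : PMF α) (g : ℕ → α → ℝ≥0∞) (hg : ∀ n a, g n a ≤ 1) :
    limsup (fun n => ∑' a, p a * g n a) atTop ≤ ∑' a, p a * limsup (fun n => g n a) atTop := by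
  let _ : MeasurableSpace α := ⊤
  have h := limsup_lintegral_le (μ := Measure.count) (f := fun n a => p a * g n a) p
    (fun n => measurable_from_top) (fun n => .of_forall fun a => mul_le_of_le_one_right' (hg n a))
    (by rw [lintegral_count, p.tsum_coe]; exact ENNReal.one_ne_top)
  simp_rw [lintegral_count] at h
  refine h.trans (ENNReal.tsum_le_tsum fun a => ?_)
  rw [ENNReal.limsup_const_mul_of_ne_top (p.apply_ne_top a)]

section Approximation

variable {S AP : Type*} (D : MarkovChain S AP) {S' : ℕ → Type*} (D' : ∀ n, MarkovChain (S' n) AP)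
  (f : ∀ n, S → S' n)

/-- Below the state `s`, the chains `D' n` agree with `D` to larger and larger depths. -/
def Approximates (s : S) : Prop :=
  ∀ k, ∀ᶠ n in atTop, LocalMorphism D (D' n) (f n) k s

variable {D D' f}

theorem Approximates.label {s : S} (h : Approximates D D' f s) :
    ∀ᶠ n in atTop, (D' n).label (f n s) = D.label s :=
  (h 1).mono fun _ h => h.1

theorem Approximates.step {s : S} (h : Approximates D D' f s) :
    ∀ᶠ n in atTop, (D' n).step (f n s) = (D.step s).map (f n) :=
  (h 1).mono fun _ h => h.2.1

theorem Approximates.succ {s t : S} (h : Approximates D D' f s) (ht : t ∈ (D.step s).support) :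
    Approximates D D' f t :=
  fun k => (h (k + 1)).mono fun _ h => h.2.2 t ht

variable (D D' f) in
/-- A closedness condition on predicates under approximation. -/
def PassesToLimit (A : S → Prop) (A' : ∀ n, S' n → Prop) : Prop :=
  ∀ s, Approximates D D' f s → (∃ᶠ n in atTop, A' n (f n s)) → A s

theorem PassesToLimit.and {A B : S → Prop} {A' B' : ∀ n, S' n → Prop}
    (hA : PassesToLimit D D' f A A') (hB : PassesToLimit D D' f B B') :
    PassesToLimit D D' f (fun s => A s ∧ B s) (fun n s => A' n s ∧ B' n s) :=
  fun s hs h => ⟨hA s hs (h.mono fun _ h => h.1), hB s hs (h.mono fun _ h => h.2)⟩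

/-- If a disjunction holds infinitely often, so does one of the disjuncts. In contrapositive form,
closedness says that where the limit predicate fails, the approximating ones eventually fail. -/
theorem PassesToLimit.or {A B : S → Prop} {A' B' : ∀ n, S' n → Prop}
    (hA : PassesToLimit D D' f A A') (hB : PassesToLimit D D' f B B') :
    PassesToLimit D D' f (fun s => A s ∨ B s) (fun n s => A' n s ∨ B' n s) :=
  fun s hs h => (frequently_or_distrib.1 h).imp (hA s hs) (hB s hs)

/-- Eventually the step of `D' n` is the image of that of `D`, so all sums can be taken against one
fixed distribution, to which reverse Fatou applies. -/
theorem Approximates.limsup_tsum_step_le {s : S} (h : Approximates D D' f s)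
    (g' : ∀ n, S' n → ℝ≥0∞) (hg' : ∀ n t, g' n t ≤ 1) (g : S → ℝ≥0∞)
    (hg : ∀ t ∈ (D.step s).support, limsup (fun n => g' n (f n t)) atTop ≤ g t) :
    limsup (fun n => ∑' t, (D' n).step (f n s) t * g' n t) atTop ≤ ∑' t, D.step s t * g t := by
  have h1 : (fun n => ∑' t, (D' n).step (f n s) t * g' n t) =ᶠ[atTop]
      fun n => ∑' t, D.step s t * g' n (f n t) := by
    filter_upwards [h.step] with n hn
    rw [hn, tsum_map_mul]
  rw [limsup_congr h1]
  refine (limsup_tsum_mul_le _ _ fun n t => hg' n _).trans (ENNReal.tsum_le_tsum fun t => ?_)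
  by_cases ht : t ∈ (D.step s).support
  · exact mul_le_mul_right (hg t ht) _
  · rw [PMF.mem_support_iff, not_not] at ht
    simp [ht]

theorem le_of_frequently_le_of_limsup_le {u : ℕ → ℝ≥0∞} {a b : ℝ≥0∞}
    (h : ∃ᶠ n in atTop, a ≤ u n) (hu : limsup u atTop ≤ b) : a ≤ b :=
  (le_limsup_of_frequently_le h).trans hu

theorem PassesToLimit.next {A : S → Prop} {A' : ∀ n, S' n → Prop}
    (hA : PassesToLimit D D' f A A') (q : ℝ≥0∞) :
    PassesToLimit D D' f (fun s => q ≤ ∑' t, D.step s t * Set.indicator {t | A t} 1 t)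
      (fun n s => q ≤ ∑' t, (D' n).step s t * Set.indicator {t | A' n t} 1 t) := by
  intro s hs h
  refine le_of_frequently_le_of_limsup_le h (hs.limsup_tsum_step_le _ (fun n t => ?_) _
    fun t ht => ?_)
  · exact Set.indicator_le_self' (fun _ _ => zero_le) t
  · by_cases hAt : A t
    · rw [Set.indicator_of_mem (by exact hAt)]
      exact limsup_le_of_le (by isBoundedDefault)
        (.of_forall fun n => Set.indicator_le_self' (fun _ _ => zero_le) _)
    · refine limsup_le_of_le (by isBoundedDefault) ?_
      filter_upwards [not_frequently.1 (mt (hA t (hs.succ ht)) hAt)] with n hn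
      rw [Set.indicator_of_notMem (by exact hn)]
      exact zero_le

variable [Countable S] [∀ n, Countable (S' n)]

theorem Approximates.limsup_weakUntilUpTo_le {A B : S → Prop} {A' B' : ∀ n, S' n → Prop}
    (hA : PassesToLimit D D' f A A') (hB : PassesToLimit D D' f B B') (m : ℕ) {s : S}
    (hs : Approximates D D' f s) :
    limsup (fun n => (D' n).pathMeasure (f n s) (weakUntilUpTo (A' n) (B' n) m)) atTop ≤
      D.pathMeasure s (weakUntilUpTo A B m) := by
  induction m generalizing s with
  | zero =>
    let _ : MeasurableSpace S := ⊤
    have := D.isProbabilityMeasure_pathMeasure s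
    have : D.pathMeasure s (weakUntilUpTo A B 0) = 1 := measure_univ
    rw [this]
    exact limsup_le_of_le (by isBoundedDefault)
      (.of_forall fun n => (D' n).pathMeasure_le_one _ _)
  | succ m ih =>
    rw [D.pathMeasure_weakUntilUpTo_succ]
    split_ifs with hBs hAs
    · exact limsup_le_of_le (by isBoundedDefault)
        (.of_forall fun n => (D' n).pathMeasure_le_one _ _)
    -- Eventually `B' n` fails too, so the recursion bounds the probability by the sum over
    -- successors, whether or not `A' n` holds.
    · have hB' := not_frequently.1 (mt (hB s hs) hBs)
      refine le_trans (limsup_le_limsup (hB'.mono fun n hn => ?_)) (hs.limsup_tsum_step_le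
        (fun n t => (D' n).pathMeasure t (weakUntilUpTo (A' n) (B' n) m))
        (fun n t => (D' n).pathMeasure_le_one _ _) _ fun t ht => ih (hs.succ ht))
      beta_reduce
      rw [(D' n).pathMeasure_weakUntilUpTo_succ, if_neg hn]
      split_ifs
      exacts [le_rfl, zero_le]
    · have hB' := not_frequently.1 (mt (hB s hs) hBs)
      have hA' := not_frequently.1 (mt (hA s hs) hAs)
      refine limsup_le_of_le (by isBoundedDefault) ?_
      filter_upwards [hA', hB'] with n hAn hBn
      rw [(D' n).pathMeasure_weakUntilUpTo_succ, if_neg hBn, if_neg hAn]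

/-- The horizon `m` is fixed while `n` tends to infinity, and only then is the infimum over `m`
taken; thus no uniformity in the horizon is needed. -/
theorem PassesToLimit.weakUntil {A B : S → Prop} {A' B' : ∀ n, S' n → Prop}
    (hA : PassesToLimit D D' f A A') (hB : PassesToLimit D D' f B B') (q : ℝ≥0∞) :
    PassesToLimit D D' f (fun s => q ≤ D.pathMeasure s (weakUntil A B))
      (fun n s => q ≤ (D' n).pathMeasure s (weakUntil (A' n) (B' n))) := by
  intro s hs h
  rw [D.pathMeasure_weakUntil]
  refine le_iInf fun m => le_of_frequently_le_of_limsup_le (h.mono fun n hn => hn.trans ?_)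
    (hs.limsup_weakUntilUpTo_le hA hB m)
  rw [(D' n).pathMeasure_weakUntil]
  exact iInf_le _ m

/-- Safe formulas are preserved by approximation. -/
theorem IsSafe.passesToLimit {Φ : StateFormula AP} (hΦ : IsSafe Φ) :
    PassesToLimit D D' f (D.Sat Φ) (fun n => (D' n).Sat Φ) := by
  induction hΦ with
  | literal h =>
    intro s hs hf
    obtain ⟨n, hn, hl⟩ := (hf.and_eventually hs.label).exists
    exact (h.sat_congr hl).1 hn
  | next q _ ih =>
    have := ih.next (ENNReal.ofReal q)
    simpa only [PassesToLimit, MarkovChain.sat_next_iff] using this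
  | and _ _ ih₁ ih₂ => simpa only [PassesToLimit, MarkovChain.Sat] using ih₁.and ih₂
  | or _ _ ih₁ ih₂ => simpa only [PassesToLimit, MarkovChain.Sat] using ih₁.or ih₂
  | wuntl q _ _ ih₁ ih₂ =>
    have := ih₁.weakUntil ih₂ (ENNReal.ofReal q)
    simpa only [PassesToLimit, MarkovChain.sat_wuntl_iff] using this
  | untl q _ _ ih₁ ih₂ =>
    -- The hypotheses concern `¬ Φ₁` and `¬ Φ₂`; the complement of `Φ₁ U Φ₂` is `¬ Φ₂ W (¬ Φ₁ ∧ ¬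
    -- Φ₂)`.
    have := ih₂.weakUntil (ih₁.and ih₂) (ENNReal.ofReal (1 - q))
    simp only [PassesToLimit, MarkovChain.sat_untl_iff]
    simpa only [PassesToLimit, MarkovChain.Sat] using this
  | of_pnf _ ih => simpa only [PassesToLimit, MarkovChain.sat_pnf] using ih

end Approximation

/-! ### Probability mass functions -/

theorem pmf_eq_of_le {α : Type*} {p q : PMF α} (h : ∀ a, p a ≤ q a) : p = q := by
  ext a
  by_contra ha
  have := ENNReal.tsum_lt_tsum (by rw [p.tsum_coe]; exact ENNReal.one_ne_top) h
    (lt_of_le_of_ne (h a) ha)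
  rw [p.tsum_coe, q.tsum_coe] at this
  exact lt_irrefl _ this

theorem pmf_map_apply_of_injOn {α β : Type*} {p : PMF α} {f : α → β}
    (hf : Set.InjOn f p.support) {a : α} (ha : a ∈ p.support) : p.map f (f a) = p a := by
  classical
  rw [PMF.map_apply, tsum_eq_single a, if_pos rfl]
  intro b hb
  split_ifs with h
  · by_contra hpb
    exact hb (hf ((PMF.mem_support_iff _ _).2 hpb) ha h.symm)
  · rfl

/-- The values of `q` on the image already exhaust its total mass one. -/
theorem pmf_eq_map_of_injOn {α β : Type*} {p : PMF α} {q : PMF β} {f : α → β}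
    (hf : Set.InjOn f p.support) (h : ∀ a ∈ p.support, q (f a) = p a) : q = p.map f := by
  refine (pmf_eq_of_le fun b => ?_).symm
  by_cases hb : b ∈ (p.map f).support
  · obtain ⟨a, ha, rfl⟩ := (PMF.mem_support_map_iff _ _ _).1 hb
    rw [pmf_map_apply_of_injOn hf ha, h a ha]
  · rw [PMF.mem_support_iff, not_not] at hb
    rw [hb]
    exact zero_le

/-! ### Probabilistic trees as Markov chains -/

namespace PTree

variable {N AP : Type*} {T : PTree N AP}

theorem IsTotal.exists_prob_pos (hT : T.IsTotal) (w : T.nodes) : ∃ w', 0 < T.prob w w' := by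
  obtain ⟨π, hπ, ⟨l, rfl⟩, hne⟩ := hT w w.2
  cases l with
  | nil => simp at hne
  | cons n l =>
    have : w.1 ++ [n] ∈ T.nodes :=
      T.prefix_closed _ hπ _ ⟨l, by simp⟩ (by simp)
    exact ⟨⟨_, this⟩, (T.prob_pos_iff _ _).2 ⟨n, rfl⟩⟩

theorem ne_nil (w : T.nodes) : w.1 ≠ [] := fun h => T.nil_notMem (h ▸ w.2)

/-- A total tree as a Markov chain on its nodes. -/
noncomputable def toChain (T : PTree N AP) (hT : T.IsTotal) : MarkovChain T.nodes AP where
  step w := ⟨T.prob w, by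
    rw [← T.prob_sum w (hT.exists_prob_pos w)]
    exact ENNReal.summable.hasSum⟩
  label := T.label
  init := ⟨[T.root.choose], T.root.choose_spec.1⟩

theorem toChain_step_apply (hT : T.IsTotal) (w w' : T.nodes) :
    (T.toChain hT).step w w' = T.prob w w' := rfl

theorem mem_support_toChain_step (hT : T.IsTotal) {w w' : T.nodes} :
    w' ∈ ((T.toChain hT).step w).support ↔ ∃ n, w'.1 = w.1 ++ [n] := by
  rw [PMF.mem_support_iff, toChain_step_apply, ← pos_iff_ne_zero, T.prob_pos_iff]

theorem eq_init_of_length_eq_one (hT : T.IsTotal) {w : T.nodes} (hw : w.1.length = 1) :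
    w = (T.toChain hT).init := by
  obtain ⟨n, hn⟩ := List.length_eq_one_iff.1 hw
  refine Subtype.ext ?_
  have hmem : [n] ∈ T.nodes := by
    rw [← hn]
    exact w.2
  rw [hn, T.root.choose_spec.2 n hmem]
  rfl

theorem length_init (hT : T.IsTotal) : (T.toChain hT).init.1.length = 1 := rfl

/-- The part of a tree up to the nodes of length `n + 1`. -/
def truncate (T : PTree N AP) (n : ℕ) : PTree N AP where
  nodes := {π | π ∈ T.nodes ∧ π.length ≤ n + 1}
  nil_notMem h := T.nil_notMem h.1
  prefix_closed π h π' h' h0 := ⟨T.prefix_closed π h.1 π' h' h0, h'.length_le.trans h.2⟩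
  root := by
    obtain ⟨r, hr, hr'⟩ := T.root
    exact ⟨r, ⟨hr, by simp⟩, fun s hs => hr' s hs.1⟩
  label π := T.label ⟨π.1, π.2.1⟩
  prob π π' := T.prob ⟨π.1, π.2.1⟩ ⟨π'.1, π'.2.1⟩
  prob_pos_iff π π' := T.prob_pos_iff _ _
  prob_sum := by
    rintro π ⟨π', h⟩
    obtain ⟨m, hm⟩ := (T.prob_pos_iff _ _).1 h
    -- A node that keeps one child keeps all of them, so no probability is lost; nodes of length `n
    -- + 1` become leaves.
    have hlen : π.1.length + 1 ≤ n + 1 := by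
      have := π'.2.2
      rw [show π'.1 = π.1 ++ [m] from hm] at this
      simpa using this
    rw [← T.prob_sum ⟨π.1, π.2.1⟩ ⟨_, h⟩]
    let ι : {π | π ∈ T.nodes ∧ π.length ≤ n + 1} → T.nodes := fun π => ⟨π.1, π.2.1⟩
    have hι : Function.Injective ι := fun a b h => Subtype.ext (congrArg (fun w => w.1) h)
    refine hι.tsum_eq (f := T.prob ⟨π.1, π.2.1⟩) fun w hw => ?_
    obtain ⟨k, hk⟩ := (T.prob_pos_iff _ _).1 (pos_iff_ne_zero.2 hw)
    exact ⟨⟨w.1, w.2, by rw [hk]; simpa using hlen⟩, rfl⟩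

theorem truncate_mem_finPrefixes (T : PTree N AP) (n : ℕ) : T.truncate n ∈ T.finPrefixes :=
  ⟨⟨n + 1, fun _ h => h.2⟩, fun _ h => h.1, fun _ => rfl, fun _ _ => rfl⟩

end PTree

/-! ### Unfoldings -/

namespace MarkovChain

variable {S AP : Type*} {D : MarkovChain S AP}

theorem getLast?_node (π : {π : List S // D.Node π}) : π.1.getLast? = some (Node.last π) :=
  List.getLast?_eq_some_getLast π.2.ne_nil

theorem unfolding_prob_of_pos {π π' : D.unfolding.nodes} (h : 0 < D.unfolding.prob π π') :
    D.unfolding.prob π π' = D.step (Node.last π) (Node.last π') :=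
  if_pos ((D.unfolding.prob_pos_iff _ _).1 h)

theorem eq_append_last_of_prob_pos {π π' : D.unfolding.nodes} (h : 0 < D.unfolding.prob π π') :
    π'.1 = π.1 ++ [Node.last π'] := by
  obtain ⟨t, ht⟩ := (D.unfolding.prob_pos_iff _ _).1 h
  have : Node.last π' = t := by simp [Node.last, ht]
  rw [this, ht]

theorem unfolding_isTotal (D : MarkovChain S AP) : D.unfolding.IsTotal := by
  intro π hπ
  obtain ⟨t, ht⟩ := (D.step (π.getLast (Node.ne_nil hπ))).support_nonempty
  exact ⟨π ++ [t], Node.append hπ ht, List.prefix_append _ _, by simp⟩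

end MarkovChain

theorem PTree.Isomorphic.isTotal {N N' AP : Type*} {T : PTree N AP} {T' : PTree N' AP}
    (h : T.Isomorphic T') (hT : T.IsTotal) : T'.IsTotal := by
  obtain ⟨e, -, he⟩ := h
  intro π hπ
  obtain ⟨w, hw⟩ := hT.exists_prob_pos (e.symm ⟨π, hπ⟩)
  rw [← he, e.apply_symm_apply] at hw
  obtain ⟨n, hn⟩ := (T'.prob_pos_iff _ _).1 hw
  exact ⟨_, (e w).2, ⟨[n], hn.symm⟩, by simp [hn]⟩

/-- The root is recognised by having no incoming edge of positive probability, a property that an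
isomorphism preserves. -/
theorem PTree.length_eq_one_of_isomorphic {N N' AP : Type*} {T : PTree N AP} {T' : PTree N' AP}
    (e : T.nodes ≃ T'.nodes) (he : ∀ π π', T'.prob (e π) (e π') = T.prob π π')
    {w : T'.nodes} (hw : w.1.length = 1) : (e.symm w).1.length = 1 := by
  by_contra hne
  rcases List.eq_nil_or_concat (e.symm w).1 with h | ⟨l, a, h⟩
  · exact T.ne_nil _ h
  · have hl : l ≠ [] := by
      rintro rfl
      exact hne (by rw [h]; rfl)
    rw [List.concat_eq_append] at h
    have hmem : l ∈ T.nodes :=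
      T.prefix_closed _ (e.symm w).2 l ⟨[a], h.symm⟩ hl
    have hpos := (T.prob_pos_iff ⟨l, hmem⟩ (e.symm w)).2 ⟨a, h⟩
    rw [← he, e.apply_symm_apply] at hpos
    obtain ⟨n, hn⟩ := (T'.prob_pos_iff _ _).1 hpos
    have := T'.ne_nil (e ⟨l, hmem⟩)
    rw [hn] at hw
    exact this (List.length_eq_zero_iff.1 (by simpa using hw))

-- Truncated trees embedded in unfoldings.

section TruncationEmbedding

variable {N S AP : Type*} {T : PTree N AP} (hT : T.IsTotal) {n : ℕ} {D : MarkovChain S AP}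
  {g : (T.truncate n).nodes → D.unfolding.nodes} (hg : Function.Injective g)
  (hprob : ∀ w w', D.unfolding.prob (g w) (g w') = (T.truncate n).prob w w')
  {f : T.nodes → S} (hf : ∀ w, f ⟨w.1, w.2.1⟩ = MarkovChain.Node.last (g w))
include hg hprob hf

/-- In an unfolding a child is its parent followed by its last state, so siblings have different
last states. The bound on `w` keeps its children inside the truncation. -/
theorem injOn_of_truncate_embedding {w : T.nodes} (hw : w.1.length ≤ n) :
    Set.InjOn f ((T.toChain hT).step w).support ∧
      ∀ w' ∈ ((T.toChain hT).step w).support, D.step (f w) (f w') = T.prob w w' := by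
  have hlen : ∀ w' ∈ ((T.toChain hT).step w).support, w'.1.length ≤ n + 1 := by
    intro w' h
    obtain ⟨m, hm⟩ := (T.mem_support_toChain_step hT).1 h
    rw [hm]
    simpa using hw
  let w₀ : (T.truncate n).nodes := ⟨w.1, w.2, hw.trans (Nat.le_succ n)⟩
  have hpos : ∀ w' (h : w' ∈ ((T.toChain hT).step w).support),
      0 < D.unfolding.prob (g w₀) (g ⟨w'.1, w'.2, hlen w' h⟩) := by
    intro w' h
    rw [hprob]
    exact (T.prob_pos_iff _ _).2 ((T.mem_support_toChain_step hT).1 h)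
  constructor
  · intro a ha b hb hab
    have h1 := MarkovChain.eq_append_last_of_prob_pos (hpos a ha)
    have h2 := MarkovChain.eq_append_last_of_prob_pos (hpos b hb)
    rw [← hf] at h1 h2
    have h3 := hg (Subtype.ext (h1.trans (by rw [show f ⟨a.1, _⟩ = f ⟨b.1, _⟩ from hab, ← h2])))
    exact Subtype.ext (congrArg (fun w => w.1) h3)
  · intro w' h
    have h1 := MarkovChain.unfolding_prob_of_pos (hpos w' h)
    rw [← hf, ← hf, hprob] at h1
    exact h1.symm

theorem step_eq_map_of_truncate_embedding {w : T.nodes} (hw : w.1.length ≤ n) :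
    D.step (f w) = ((T.toChain hT).step w).map f :=
  have h := injOn_of_truncate_embedding hT hg hprob hf hw
  pmf_eq_map_of_injOn h.1 h.2

theorem localMorphism_of_truncate_embedding
    (hlabel : ∀ w, D.unfolding.label (g w) = (T.truncate n).label w) (k : ℕ) {w : T.nodes}
    (hw : w.1.length + k ≤ n + 1) : LocalMorphism (T.toChain hT) D f k w := by
  induction k generalizing w with
  | zero => trivial
  | succ k ih =>
    refine ⟨?_, step_eq_map_of_truncate_embedding hT hg hprob hf (by omega), fun t ht => ih ?_⟩
    · have := hlabel ⟨w.1, w.2, by omega⟩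
      have hf' := hf ⟨w.1, w.2, by omega⟩
      change D.label (MarkovChain.Node.last _) = T.label w at this
      rwa [← hf'] at this
    · obtain ⟨m, hm⟩ := (T.mem_support_toChain_step hT).1 ht
      rw [hm, List.length_append, List.length_singleton]
      omega

end TruncationEmbedding

/-- A chain whose unfolding contains a truncation of `T` up to isomorphism is approximately the
chain of `T`. -/
theorem exists_localMorphism {N S AP : Type*} {T : PTree N AP} (hT : T.IsTotal) {n : ℕ}
    {D : MarkovChain S AP} {T₂ : PTree N AP} (hiso : D.unfolding.Isomorphic T₂)
    (hpre : (T.truncate n).IsPrefix T₂) :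
    ∃ f : T.nodes → S, f (T.toChain hT).init = D.init ∧
      ∀ k (w : T.nodes), w.1.length + k ≤ n + 1 → LocalMorphism (T.toChain hT) D f k w := by
  classical
  obtain ⟨e, he1, he2⟩ := hiso
  obtain ⟨hsub, hp1, hp2⟩ := hpre
  let g : (T.truncate n).nodes → D.unfolding.nodes := fun w => e.symm ⟨w.1, hsub w.2⟩
  -- The value beyond the truncation is arbitrary.
  let f : T.nodes → S := fun w =>
    if h : w.1.length ≤ n + 1 then MarkovChain.Node.last (g ⟨w.1, w.2, h⟩) else D.init
  have hg : Function.Injective g := fun a b h =>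
    Subtype.ext (congrArg (fun w => w.1) (e.symm.injective h))
  have hf : ∀ w, f ⟨w.1, w.2.1⟩ = MarkovChain.Node.last (g w) := fun w => dif_pos w.2.2
  have hprob : ∀ w w', D.unfolding.prob (g w) (g w') = (T.truncate n).prob w w' := by
    intro w w'
    rw [← he2, e.apply_symm_apply, e.apply_symm_apply, hp2]
  have hlabel : ∀ w, D.unfolding.label (g w) = (T.truncate n).label w := by
    intro w
    rw [← he1, e.apply_symm_apply, hp1]
  refine ⟨f, ?_, fun k w hw =>
    localMorphism_of_truncate_embedding hT hg hprob hf hlabel k hw⟩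
  have hi : (T.toChain hT).init.1 ∈ (T.truncate n).nodes :=
    ⟨(T.toChain hT).init.2, by rw [T.length_init hT]; omega⟩
  have h1 : (g ⟨_, hi⟩).1.length = 1 := PTree.length_eq_one_of_isomorphic e he2 rfl
  refine (hf ⟨_, hi⟩).trans ?_
  obtain ⟨s, hs⟩ := List.length_eq_one_iff.1 h1
  have h2 : D.Node [s] := hs ▸ (g ⟨_, hi⟩).2
  rw [← h2.eq_init]
  simp [MarkovChain.Node.last, hs]

/-! ### The unfolding of a tree -/

namespace PTree

variable {N AP : Type*} {T : PTree N AP} (hT : T.IsTotal)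

theorem length_of_node_toChain {u : List T.nodes} (hu : (T.toChain hT).Node u) :
    ∀ w ∈ u.getLast?, w.1.length = u.length := by
  induction hu with
  | init => simp [length_init]
  | step h ht ih =>
    obtain ⟨m, hm⟩ := (mem_support_toChain_step hT).1 ht
    simp only [List.getLast?_append, List.getLast?_singleton, Option.some_or, Option.mem_def,
      Option.some.injEq, List.length_append, List.length_singleton, forall_eq'] at ih ⊢
    simp [hm, ih]

/-- A path in the chain of a tree lists the non-empty prefixes of its last node, and is therefore
determined by that node. -/
theorem node_toChain_injective {u v : List T.nodes} (hu : (T.toChain hT).Node u)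
    (hv : (T.toChain hT).Node v) (h : u.getLast? = v.getLast?) : u = v := by
  induction hu generalizing v with
  | init =>
    have hl := length_of_node_toChain hT hv _ h.symm
    rw [List.getLast_singleton, length_init] at hl
    obtain ⟨x, rfl⟩ := List.length_eq_one_iff.1 hl.symm
    rw [hv.eq_init]
  | @step π s t hπ ht ih =>
    have hl := length_of_node_toChain hT hv t (by rw [← h]; simp)
    have hl' := length_of_node_toChain hT (.step hπ ht) t (by simp)
    cases hv with
    | init => simp [hl] at hl'
    | @step π' s' t' hπ' ht' =>
      obtain rfl : t = t' := by simpa using h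
      obtain ⟨m, hm⟩ := (mem_support_toChain_step hT).1 ht
      obtain ⟨m', hm'⟩ := (mem_support_toChain_step hT).1 ht'
      obtain rfl : s = s' := Subtype.ext (List.append_inj' (hm.symm.trans hm') rfl).1
      rw [ih hπ' (by simp)]

theorem exists_node_toChain (w : T.nodes) :
    ∃ u, (T.toChain hT).Node u ∧ u.getLast? = some w := by
  obtain ⟨π, hπ⟩ := w
  induction π using List.reverseRecOn with
  | nil => exact absurd hπ T.nil_notMem
  | append_singleton π a ih =>
    rcases eq_or_ne π [] with rfl | h0
    · refine ⟨[(T.toChain hT).init], .init, ?_⟩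
      rw [← T.eq_init_of_length_eq_one hT (w := ⟨_, hπ⟩) rfl]
      rfl
    · have hπ' := T.prefix_closed _ hπ π (List.prefix_append _ _) h0
      obtain ⟨u, hu, hl⟩ := ih hπ'
      obtain ⟨v, rfl⟩ := List.getLast?_eq_some_iff.1 hl
      exact ⟨_, .step hu ((mem_support_toChain_step hT).2 ⟨a, rfl⟩), List.getLast?_concat⟩

theorem unfolding_toChain_isomorphic : (T.toChain hT).unfolding.Isomorphic T := by
  have hbij : Function.Bijective (fun u : (T.toChain hT).unfolding.nodes =>
      (MarkovChain.Node.last u : T.nodes)) := by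
    constructor
    · intro u v h
      refine Subtype.ext (node_toChain_injective hT u.2 v.2 ?_)
      rw [MarkovChain.getLast?_node u, MarkovChain.getLast?_node v]
      exact congrArg some h
    · intro w
      obtain ⟨u, hu, h⟩ := exists_node_toChain hT w
      refine ⟨⟨u, hu⟩, Option.some_injective _ ?_⟩
      rw [← h]
      exact (MarkovChain.getLast?_node _).symm
  refine ⟨Equiv.ofBijective _ hbij, fun _ => rfl, fun u v => ?_⟩
  change T.prob (MarkovChain.Node.last u) (MarkovChain.Node.last v) = _
  rcases (zero_le (a := (T.toChain hT).unfolding.prob u v)).eq_or_lt with h | h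
  · rw [← h]
    -- An edge of `T` between the last nodes would extend `u` to a path with the same last node as
    -- `v`, hence to `v` itself.
    by_contra hne
    have hs : MarkovChain.Node.last v ∈ ((T.toChain hT).step (MarkovChain.Node.last u)).support :=
      (PMF.mem_support_iff _ _).2 hne
    have h' := MarkovChain.Node.append u.2 hs
    have : v.1 = u.1 ++ [MarkovChain.Node.last v] := by
      refine node_toChain_injective hT v.2 h' ?_
      rw [MarkovChain.getLast?_node v, List.getLast?_concat]
    exact h.not_lt (((T.toChain hT).unfolding.prob_pos_iff _ _).2 ⟨_, this⟩)
  · rw [MarkovChain.unfolding_prob_of_pos h]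
    rfl

end PTree

/-! ### Literal unfoldings -/

namespace PTree

variable {N AP : Type*} {T : PTree N AP}

/-- The last entry of a node. -/
def last (w : T.nodes) : N := w.1.getLast (T.ne_nil w)

theorem last_eq_of_eq_append {w : T.nodes} {π : List N} {n : N} (h : w.1 = π ++ [n]) :
    last w = n := by
  simp [last, h]

theorem eq_append_last {w w' : T.nodes} (h : ∃ n, w'.1 = w.1 ++ [n]) :
    w'.1 = w.1 ++ [last w'] := by
  obtain ⟨n, hn⟩ := h
  rw [last_eq_of_eq_append hn, hn]

theorem injOn_last (hT : T.IsTotal) (w : T.nodes) :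
    Set.InjOn last ((T.toChain hT).step w).support := by
  intro a ha b hb hab
  refine Subtype.ext ?_
  rw [eq_append_last ((mem_support_toChain_step hT).1 ha),
    eq_append_last ((mem_support_toChain_step hT).1 hb), hab]

theorem IsPrefix.eq_of_nodes_subset {T₁ T₂ : PTree N AP} (h : T₁.IsPrefix T₂)
    (h' : T₂.nodes ⊆ T₁.nodes) : T₁ = T₂ := by
  obtain ⟨hsub, h1, h2⟩ := h
  obtain ⟨W₁, _, _, _, L₁, P₁, _, _⟩ := T₁
  obtain ⟨W₂, _, _, _, L₂, P₂, _, _⟩ := T₂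
  obtain rfl : W₁ = W₂ := hsub.antisymm h'
  obtain rfl : L₂ = L₁ := funext h1
  obtain rfl : P₂ = P₁ := funext fun w => funext (h2 w)
  rfl

/-- A tree in which labels and branching probabilities depend on the last entry of a node only
is an unfolding. -/
theorem eq_unfolding (hT : T.IsTotal) {D : MarkovChain N AP}
    (hinit : last (T.toChain hT).init = D.init) (hlabel : ∀ w, D.label (last w) = T.label w)
    (hstep : ∀ w, D.step (last w) = ((T.toChain hT).step w).map last) : T = D.unfolding := by
  have hsub : ∀ π ∈ T.nodes, D.Node π := by
    intro π hπ
    induction π using List.reverseRecOn with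
    | nil => exact absurd hπ T.nil_notMem
    | append_singleton π a ih =>
      rcases eq_or_ne π [] with rfl | h0
      · have h := T.eq_init_of_length_eq_one hT (w := ⟨_, hπ⟩) rfl
        have ha : last (⟨_, hπ⟩ : T.nodes) = a := last_eq_of_eq_append (π := []) rfl
        rw [h, hinit] at ha
        rw [← ha]
        exact .init
      · have hπ' := T.prefix_closed _ hπ π (List.prefix_append _ _) h0
        refine MarkovChain.Node.append (ih hπ') ?_
        have h := hstep ⟨π, hπ'⟩
        rw [last] at h
        rw [h, PMF.mem_support_map_iff]
        exact ⟨⟨_, hπ⟩, (mem_support_toChain_step hT).2 ⟨a, rfl⟩, last_eq_of_eq_append rfl⟩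
  refine IsPrefix.eq_of_nodes_subset ⟨hsub, fun w => hlabel w, fun w w' => ?_⟩ fun π hπ => ?_
  · rcases (zero_le (a := T.prob w w')).eq_or_lt with h | h
    · rw [← h]
      by_contra hne
      refine h.not_lt ((T.prob_pos_iff _ _).2 ?_)
      exact (D.unfolding.prob_pos_iff _ _).1 (pos_iff_ne_zero.2 hne)
    · have h' := (T.prob_pos_iff _ _).1 h
      have hpos := (D.unfolding.prob_pos_iff ⟨w.1, hsub _ w.2⟩ ⟨w'.1, hsub _ w'.2⟩).2 h'
      rw [MarkovChain.unfolding_prob_of_pos hpos]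
      change D.step (last w) (last w') = _
      rw [hstep, pmf_map_apply_of_injOn (injOn_last hT w) ((mem_support_toChain_step hT).2 h')]
      rfl
  · induction hπ with
    | init =>
      rw [← hinit]
      exact (T.toChain hT).init.2
    | @step π s t _ ht ih =>
      have hs : last (⟨_, ih⟩ : T.nodes) = s := last_eq_of_eq_append rfl
      rw [← hs, hstep, PMF.mem_support_map_iff] at ht
      obtain ⟨w, hw, rfl⟩ := ht
      rw [← show w.1 = π ++ [s] ++ [last w] from
        eq_append_last ((mem_support_toChain_step hT).1 hw)]
      exact w.2

theorem label_and_step_of_truncate_isPrefix (hT : T.IsTotal) {n : ℕ} {D : MarkovChain N AP}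
    (h : (T.truncate n).IsPrefix D.unfolding) {w : T.nodes} (hw : w.1.length ≤ n) :
    D.label (last w) = T.label w ∧ D.step (last w) = ((T.toChain hT).step w).map last := by
  obtain ⟨hsub, h1, h2⟩ := h
  exact ⟨h1 ⟨w.1, w.2, hw.trans (Nat.le_succ n)⟩, step_eq_map_of_truncate_embedding hT
    (g := fun w => ⟨w.1, hsub w.2⟩)
    (fun a b h => Subtype.ext (congrArg (fun w : D.unfolding.nodes => w.1) h)) h2
    (fun _ => rfl) hw⟩

theorem init_of_truncate_isPrefix (hT : T.IsTotal) {n : ℕ} {D : MarkovChain N AP}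
    (h : (T.truncate n).IsPrefix D.unfolding) : last (T.toChain hT).init = D.init :=
  MarkovChain.Node.eq_init (h.1 ⟨(T.toChain hT).init.2, by simp⟩)

/-- A total tree all of whose truncations are prefixes of unfoldings of chains on a fixed state
space is an unfolding, and its chain is approximated by these chains. -/
theorem exists_eq_unfolding (hT : T.IsTotal) {D' : ℕ → MarkovChain N AP}
    (h : ∀ n, (T.truncate n).IsPrefix (D' n).unfolding) :
    ∃ D : MarkovChain N AP, T = D.unfolding ∧ Approximates D D' (fun _ => id) D.init := by
  classical
  have key := fun (w : T.nodes) {n : ℕ} => label_and_step_of_truncate_isPrefix hT (h n) (w := w)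
  -- Both nodes lie in the truncation at the larger of their lengths, hence in the unfolding of a
  -- single chain, where label and step depend only on the last state.
  have hcongr : ∀ w w' : T.nodes, last w = last w' → T.label w = T.label w' ∧
      ((T.toChain hT).step w).map last = ((T.toChain hT).step w').map last := by
    intro w w' hww'
    have h1 := key w (le_max_left w.1.length w'.1.length)
    have h2 := key w' (le_max_right w.1.length w'.1.length)
    exact ⟨by rw [← h1.1, ← h2.1, hww'], by rw [← h1.2, ← h2.2, hww']⟩
  let D : MarkovChain N AP :=
    { step := fun s => if hs : ∃ w : T.nodes, last w = s
        -- States that end no node of `T` are never reached, so their transitions are immaterial.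
        then ((T.toChain hT).step hs.choose).map last else PMF.pure s
      label := fun s => {a | ∃ w : T.nodes, last w = s ∧ a ∈ T.label w}
      init := last (T.toChain hT).init }
  have hlabel : ∀ w, D.label (last w) = T.label w := by
    intro w
    ext a
    exact ⟨fun ⟨w', hw', ha⟩ => (hcongr w' w hw').1 ▸ ha, fun ha => ⟨w, rfl, ha⟩⟩
  have hstep : ∀ w, D.step (last w) = ((T.toChain hT).step w).map last := by
    intro w
    have hs : ∃ w' : T.nodes, last w' = last w := ⟨w, rfl⟩
    exact (dif_pos hs).trans (hcongr _ _ hs.choose_spec).2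
  refine ⟨D, eq_unfolding hT rfl hlabel hstep, fun k => ?_⟩
  have hlocal : ∀ n k (w : T.nodes), w.1.length + k ≤ n + 1 →
      LocalMorphism D (D' n) id k (last w) := by
    intro n k
    induction k with
    | zero => exact fun _ _ => trivial
    | succ k ih =>
      intro w hw
      have hk := key w (n := n) (by omega)
      refine ⟨hk.1.trans (hlabel w).symm, ?_, fun t ht => ?_⟩
      · rw [PMF.map_id, hstep]
        exact hk.2
      · rw [hstep, PMF.mem_support_map_iff] at ht
        obtain ⟨w', hw', rfl⟩ := ht
        obtain ⟨m, hm⟩ := (mem_support_toChain_step hT).1 hw'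
        refine ih w' ?_
        rw [hm, List.length_append, List.length_singleton]
        omega
  filter_upwards [eventually_ge_atTop k] with n hn
  exact hlocal n k _ (by rw [length_init hT]; omega)

end PTree

/-! ### Safe formulas are safety properties -/

variable {AP : Type*} {Φ : StateFormula AP}

theorem IsSafe.isSafetyProperty_unfoldingProperty (hΦ : IsSafe Φ) :
    IsSafetyProperty (unfoldingProperty Φ) := by
  refine ⟨?_, fun T hT => ⟨fun h T₁ h₁ => ⟨T, h, h₁.2⟩, fun h => ?_⟩⟩
  · rintro _ ⟨D, -, rfl⟩
    exact D.unfolding_isTotal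
  · have h' : ∀ n, ∃ D : MarkovChain ℕ AP, D.Models Φ ∧ (T.truncate n).IsPrefix D.unfolding := by
      intro n
      obtain ⟨_, ⟨D, hD, rfl⟩, hpre⟩ := h _ (T.truncate_mem_finPrefixes n)
      exact ⟨D, hD, hpre⟩
    choose D' hD' hpre using h'
    obtain ⟨D, rfl, happ⟩ := PTree.exists_eq_unfolding hT hpre
    refine ⟨D, hΦ.passesToLimit _ happ (.of_forall fun n => ?_), rfl⟩
    -- Every truncation contains the root, so all the chains start in the same state.
    have hinit : (D' n).init = D.init := by
      rw [← PTree.init_of_truncate_isPrefix hT (hpre n)]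
      exact MarkovChain.Node.eq_init (D.unfolding.toChain hT).init.2
    have := hD' n
    rwa [MarkovChain.Models, hinit] at this

theorem IsSafe.isSafetyProperty_treeProperty (hΦ : IsSafe Φ) :
    IsSafetyProperty (treeProperty Φ) := by
  refine ⟨?_, fun T hT => ⟨fun h T₁ h₁ => ⟨T, h, h₁.2⟩, fun h => ?_⟩⟩
  · rintro T ⟨S, _, D, -, hiso⟩
    exact hiso.isTotal D.unfolding_isTotal
  · have h' : ∀ n, ∃ (S : Type) (_ : Countable S) (D : MarkovChain S AP) (f : T.nodes → S),
        D.Sat Φ (f (T.toChain hT).init) ∧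
        ∀ k (w : T.nodes), w.1.length + k ≤ n + 1 → LocalMorphism (T.toChain hT) D f k w := by
      intro n
      obtain ⟨T₂, ⟨S, hS, D, hD, hiso⟩, hpre⟩ := h _ (T.truncate_mem_finPrefixes n)
      obtain ⟨f, hf, hlocal⟩ := exists_localMorphism hT hiso hpre
      exact ⟨S, hS, D, f, hf ▸ hD, hlocal⟩
    choose S hS D f hf hlocal using h'
    -- The witness is the chain on the nodes of `T`, which are countable as finite sequences over
    -- `ℕ`.
    refine ⟨T.nodes, inferInstance, T.toChain hT, hΦ.passesToLimit (f := f) _ (fun k => ?_)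
      (.of_forall hf), PTree.unfolding_toChain_isomorphic hT⟩
    filter_upwards [eventually_ge_atTop k] with n hn
    exact hlocal n k _ (by rw [PTree.length_init hT]; omega)

end PCTL

theorem mainTheorem5 {AP : Type*} [Finite AP] [Nonempty AP] (Φ : PCTL.StateFormula AP)
    (hΦ : PCTL.IsSafe Φ) :
    PCTL.IsSafetyProperty (PCTL.unfoldingProperty Φ) ∧
      PCTL.IsSafetyProperty (PCTL.treeProperty Φ) :=
  ⟨hΦ.isSafetyProperty_unfoldingProperty, hΦ.isSafetyProperty_treeProperty⟩
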